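/- Let \(n\ge 0\) be an integer and \([n]=\{1,\dots,n\}\). For a permutation \(\sigma\) of \([n]\) let \[\mathrm{Cr}(\sigma)=\{(i,j)\in[n]^2 : \sigma(i)<j \text{ and } i<\sigma^{-1}(j)\}.\] A grid configuration \(G(\sigma,E)\) consists of a permutation \(\sigma\) of \([n]\) and a set \(E\) of cells in \([n]^2\); its crossings are the elements of \(\mathrm{Cr}(\sigma)\setminus E\). A crossing \((i,j)\) of \(G(\sigma,E)\) is called maximal if \(G(\sigma,E)\) has no other crossing \((i',j')\) with \(i'\le i\) and \(j'\ge j\). A maximal crossing \(c=(i,j)\) of \(G(\sigma,E)\) can be resolved in two ways: by smoothing, which yields \(G(\sigma,E\cup\{c\})\), and by switching, which yields \(G(\sigma',E)\), where \(\sigma'(i)=j\), \(\sigma'(\sigma^{-1}(j))=\sigma(i)\) and \(\sigma'(k)=\sigma(k)\) for all \(k\ne i,\sigma^{-1}(j)\). A permutation \(\sigma\) of \([n]\) is called a web permutation if \(G(\sigma,\mathrm{Cr}(\sigma))\) can be obtained from \(G(\mathrm{id},\emptyset)\) by a finite (possibly empty) sequence of such resolutions of maximal crossings. Let the Euler numbers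 \(E_m\) (\(m\ge 0\)) be defined by the exponential generating function \[\sum_{m\ge 0}E_m\frac{z^m}{m!}=\sec z+\tan z .\] Then the number of web permutations of \([n]\) is equal to \(E_{n+1}\). -/

import Mathlib

/-- A grid configuration `G(σ, E)` on the `n` by `n` grid: a permutation `σ` (the marked cells are
`(i, σ i)`) and a set `E` of cells carrying an elbow. Rows and columns are indexed by `Fin n`
instead of `{1, …, n}`; only their order matters. -/
structure GridConfig (n : ℕ) where
  perm : Equiv.Perm (Fin n)
  elbows : Finset (Fin n × Fin n)

/-- `Cr(σ)`: the cells `(i, j)` through which both the vertical line going up from the marked cell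
`(i, σ i)` and the horizontal line going left from the marked cell `(σ⁻¹ j, j)` pass. -/
def crossings {n : ℕ} (σ : Equiv.Perm (Fin n)) : Finset (Fin n × Fin n) :=
  Finset.univ.filter fun c => σ c.1 < c.2 ∧ c.1 < σ⁻¹ c.2

/-- `d ⪰ c`: the cell `d` lies weakly to the left of and weakly above the cell `c`. -/
def UpperLeft {n : ℕ} (d c : Fin n × Fin n) : Prop :=
  d.1 ≤ c.1 ∧ c.2 ≤ d.2

namespace GridConfig

/-- The crossings that are present in `G(σ, E)`, i.e. not replaced by an elbow. -/
def unresolved {n : ℕ} (G : GridConfig n) : Finset (Fin n × Fin n) :=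
  crossings G.perm \ G.elbows

/-- `c` is a crossing of `G`, and no other crossing of `G` lies in the upper-left quadrant
at `c`. -/
def IsMaximalCrossing {n : ℕ} (G : GridConfig n) (c : Fin n × Fin n) : Prop :=
  c ∈ G.unresolved ∧ ∀ d ∈ G.unresolved, UpperLeft d c → d = c

/-- The configuration `G(id, ∅)`. -/
def start (n : ℕ) : GridConfig n := ⟨1, ∅⟩

/-- Smoothing: the crossing `c` becomes an elbow. -/
def smooth {n : ℕ} (G : GridConfig n) (c : Fin n × Fin n) : GridConfig n :=
  ⟨G.perm, insert c G.elbows⟩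

/-- Switching at `c = (i, j)`: `σ` is replaced by the permutation `σ'` with `σ' i = j`,
`σ' (σ⁻¹ j) = σ i`, and `σ' k = σ k` for all other `k`. -/
def switch {n : ℕ} (G : GridConfig n) (c : Fin n × Fin n) : GridConfig n :=
  ⟨G.perm * Equiv.swap c.1 (G.perm⁻¹ c.2), G.elbows⟩

/-- `G'` arises from `G` by resolving one maximal crossing, in one of the two ways. -/
def ResolveStep {n : ℕ} (G G' : GridConfig n) : Prop :=
  ∃ c, G.IsMaximalCrossing c ∧ (G' = G.smooth c ∨ G' = G.switch c)

end GridConfig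

/-- Web permutations: the permutations `σ` such that `G(σ, Cr(σ))`, a configuration without any
crossing left, is obtained from `G(id, ∅)` by successively resolving maximal crossings. -/
def webPermutations (n : ℕ) : Set (Equiv.Perm (Fin n)) :=
  {σ | Relation.ReflTransGen GridConfig.ResolveStep (GridConfig.start n) ⟨σ, crossings σ⟩}

/-- The formal power series `sec z + tan z = 1 / cos z + sin z / cos z`. The constant coefficient
of `cos z` is `1`, so that the inverse is a genuine one. -/
noncomputable def secAddTan : PowerSeries ℚ :=
  (PowerSeries.cos ℚ)⁻¹ + PowerSeries.sin ℚ * (PowerSeries.cos ℚ)⁻¹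

/-- The Euler numbers, defined by `∑ E_n z ^ n / n! = sec z + tan z`. -/
noncomputable def eulerNumber (n : ℕ) : ℚ :=
  (n.factorial : ℚ) * PowerSeries.coeff n secAddTan

/-!
The proof turns the set of web permutations into a recursion on words, and the recursion into the
differential equation of `sec + tan`.

*Resolving row by row.* Two distinct maximal crossings stay maximal when the other one is resolved,
and the two resolutions commute (`GridConfig.IsMaximalCrossing.resolve`,
`GridConfig.resolve_comm`). Hence the final permutations reachable from a configuration do not
depend on which maximal crossing is resolved first (`GridConfig.outcomes_eq_union`), and one may
treat the rows from the top down, each row from its largest column to its smallest. A switch at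
`(i, j)` finishes row `i` and fixes the value `j` there, whereas after a smoothing at `(i, j)` the
final value in row `i` is below `j`: so the different choices lead to different permutations. If
`a :: w` is the word of the values in the unfinished rows, the choices in the next row are to drop
`a`, or to drop `a` and put it in place of a larger letter of `w`. Therefore the number of outcomes
is `webCount`, given by `f (a :: w) = f w + ∑ f w'`, where `w'` runs over the words obtained from
`w` by replacing a letter `> a` by `a` (`GridConfig.outcomes_rowwise`).

*Decomposing words.* Dropping a letter closes a cycle of the final permutation. Let `h`, called
`cycleCount`, satisfy the same recursion, except that a letter may be dropped only at the end; it
counts the outcomes with a single cycle. The sum over all replacements obeys the Leibniz rule with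
respect to splitting a word into two complementary subwords (`replacementSum_splitSum`). By
induction on the length this gives two identities.
* `f w` is the sum of `h S * f T` over all splittings of `w` into `S` and `T` with the last position
  in `S` (`webCount_eq_splitSum`): `S` is the cycle through that position.
* `h w` is the sum of `h S * h T` over all splittings such that `T` contains the last position, and
  `S` the last but one and the least letter (`cycleCount_eq_splitSum`). This cuts the cycle
  in two before the last replacement.

*Counting.* For increasing words `f` and `h` depend on the length only. With `f m` and `h m` for
their values at length `m`, the identities become
`f (m + 1) = ∑ C(m, i) h (i + 1) f (m - i)` and `h (m + 3) = ∑ C(m, i) h (i + 2) h (m - i + 1)`.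
The series `y = sec z + tan z` satisfies `2 y' = 1 + y ^ 2`, hence `y'' = y' y`, that is
`E (m + 2) = ∑ C(m, i) E (i + 1) E (m - i)`. So `h (m + 1) = E m` and `f m = E (m + 1)`.
-/

/-! ### Consuming words by replacing letters -/

/-- The words obtained from a given one by replacing one letter larger than `a` by `a`. -/
def replacements (a : ℕ) : List ℕ → List (List ℕ)
  | [] => []
  | b :: w => (if a < b then [a :: w] else []) ++ (replacements a w).map (b :: ·)

/-- The sum of `F` over all words obtained by replacing one letter larger than `a` by `a`.
For fixed `a` this is an operator on functions of words. -/
def replacementSum (a : ℕ) (F : List ℕ → ℕ) (w : List ℕ) : ℕ :=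
  ((replacements a w).map F).sum

theorem length_of_mem_replacements {a : ℕ} {w u : List ℕ} (h : u ∈ replacements a w) :
    u.length = w.length := by
  induction w generalizing u with
  | nil => simp [replacements] at h
  | cons b w ih =>
    simp only [replacements, List.mem_append, List.mem_map] at h
    rcases h with h | ⟨v, hv, rfl⟩
    · split_ifs at h <;> simp_all
    · simp [ih hv]

theorem replacements_map {φ : ℕ → ℕ} (hφ : StrictMono φ) (a : ℕ) (w : List ℕ) :
    replacements (φ a) (w.map φ) = (replacements a w).map (List.map φ) := by
  induction w with
  | nil => simp [replacements]
  | cons b w ih =>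
    simp only [List.map_cons, replacements, ih, hφ.lt_iff_lt, List.map_append, List.map_map]
    congr 1
    split_ifs <;> simp

@[simp] theorem replacementSum_nil (a : ℕ) (F : List ℕ → ℕ) : replacementSum a F [] = 0 := rfl

theorem replacementSum_cons (a b : ℕ) (F : List ℕ → ℕ) (w : List ℕ) :
    replacementSum a F (b :: w) =
      (if a < b then F (a :: w) else 0) + replacementSum a (fun u => F (b :: u)) w := by
  simp only [replacementSum, replacements, List.map_append, List.sum_append, List.map_map]
  congr 1
  split_ifs <;> simp

theorem replacementSum_congr {a : ℕ} {F G : List ℕ → ℕ} {w : List ℕ}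
    (h : ∀ u ∈ replacements a w, F u = G u) : replacementSum a F w = replacementSum a G w := by
  rw [replacementSum, replacementSum, List.map_congr_left h]

theorem replacementSum_zero (a : ℕ) (w : List ℕ) : replacementSum a (fun _ => 0) w = 0 := by
  simp [replacementSum]

theorem replacementSum_linear (a x y : ℕ) (F G : List ℕ → ℕ) (w : List ℕ) :
    replacementSum a (fun u => x * F u + y * G u) w =
      x * replacementSum a F w + y * replacementSum a G w := by
  simp only [replacementSum, List.sum_map_add, List.sum_map_mul_left]

/-- The number of ways to consume a word from the left, where the first letter `a` is either
dropped, or moved to the place of a larger letter, which disappears. -/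
def webCount : List ℕ → ℕ
  | [] => 1
  | a :: w => webCount w + ((replacements a w).attach.map fun u => webCount u.1).sum
termination_by w => w.length
decreasing_by
  · simp
  · simp [length_of_mem_replacements u.2]

/-- The variant of `webCount` in which a letter may be dropped only when it is the last one left.
The empty word gets the value `0`. -/
def cycleCount : List ℕ → ℕ
  | [] => 0
  | a :: w => (if w = [] then 1 else 0) +
      ((replacements a w).attach.map fun u => cycleCount u.1).sum
termination_by w => w.length
decreasing_by simp [length_of_mem_replacements u.2]

@[simp] theorem webCount_nil : webCount [] = 1 := by rw [webCount]

theorem webCount_cons (a : ℕ) (w : List ℕ) :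
    webCount (a :: w) = webCount w + replacementSum a webCount w := by
  rw [webCount, replacementSum, List.attach_map_val]

theorem cycleCount_cons (a : ℕ) (w : List ℕ) :
    cycleCount (a :: w) = (if w = [] then 1 else 0) + replacementSum a cycleCount w := by
  rw [cycleCount, replacementSum, List.attach_map_val]

theorem cycleCount_singleton (a : ℕ) : cycleCount [a] = 1 := by simp [cycleCount_cons]

theorem cycleCount_cons_of_ne_nil (a : ℕ) {w : List ℕ} (hw : w ≠ []) :
    cycleCount (a :: w) = replacementSum a cycleCount w := by
  simp [cycleCount_cons, hw]

theorem webCount_map {φ : ℕ → ℕ} (hφ : StrictMono φ) (w : List ℕ) :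
    webCount (w.map φ) = webCount w := by
  induction hn : w.length using Nat.strong_induction_on generalizing w with
  | _ n ih =>
    cases w with
    | nil => rfl
    | cons a w =>
      simp only [List.length_cons] at hn
      rw [List.map_cons, webCount_cons, webCount_cons, ih w.length (by omega) w rfl,
        replacementSum, replacements_map hφ, List.map_map, replacementSum]
      congr 2
      refine List.map_congr_left fun u hu => ih u.length ?_ u rfl
      rw [length_of_mem_replacements hu]; omega

theorem cycleCount_map {φ : ℕ → ℕ} (hφ : StrictMono φ) (w : List ℕ) :
    cycleCount (w.map φ) = cycleCount w := by
  induction hn : w.length using Nat.strong_induction_on generalizing w with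
  | _ n ih =>
    cases w with
    | nil => rfl
    | cons a w =>
      simp only [List.length_cons] at hn
      rw [List.map_cons, cycleCount_cons, cycleCount_cons,
        replacementSum, replacements_map hφ, List.map_map, replacementSum]
      congr 1
      · simp
      congr 1
      refine List.map_congr_left fun u hu => ih u.length ?_ u rfl
      rw [length_of_mem_replacements hu]; omega

/-- Past the end of `l`, the values `l.sum + i` continue `l` increasingly. -/
theorem exists_strictMono_map_range {l : List ℕ} (hl : l.Pairwise (· < ·)) :
    ∃ φ : ℕ → ℕ, StrictMono φ ∧ (List.range l.length).map φ = l := by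
  refine ⟨fun i => if h : i < l.length then l[i] else l.sum + i, ?_, ?_⟩
  · refine strictMono_nat_of_lt_succ fun i => ?_
    by_cases h1 : i + 1 < l.length
    · have h2 : i < l.length := by omega
      simp only [h1, h2, dif_pos]
      exact List.pairwise_iff_getElem.1 hl i (i + 1) h2 h1 (by omega)
    · by_cases h2 : i < l.length
      · simp only [h1, h2, dif_pos, dif_neg, not_false_eq_true]
        have := List.le_sum_of_mem (List.getElem_mem h2)
        omega
      · simp only [h1, h2, dif_neg, not_false_eq_true]
        omega
  · refine List.ext_getElem (by simp) fun i h1 h2 => ?_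
    simp [h2]

theorem webCount_eq_of_pairwise {w : List ℕ} (hw : w.Pairwise (· < ·)) :
    webCount w = webCount (List.range w.length) := by
  obtain ⟨φ, hφ, h⟩ := exists_strictMono_map_range hw
  conv_lhs => rw [← h, webCount_map hφ]

theorem cycleCount_eq_of_pairwise {w : List ℕ} (hw : w.Pairwise (· < ·)) :
    cycleCount w = cycleCount (List.range w.length) := by
  obtain ⟨φ, hφ, h⟩ := exists_strictMono_map_range hw
  conv_lhs => rw [← h, cycleCount_map hφ]

/-! ### Splitting a word into two subwords -/

/-- The weighted sum of `F S * G T` over all splittings of a word into complementary subwords `S`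
and `T`. A position with entry `(x, y)` in the list of weights contributes the factor `x` if it
belongs to `S` and `y` if it belongs to `T`; thus `(1, 1)` leaves the position free, and `(1, 0)`
and `(0, 1)` force it into `S` and into `T`. The sum is `0` if the lengths do not match. -/
def splitSum : List (ℕ × ℕ) → (List ℕ → ℕ) → (List ℕ → ℕ) → List ℕ → ℕ
  | [], F, G, [] => F [] * G []
  | p :: π, F, G, b :: w =>
    p.1 * splitSum π (fun u => F (b :: u)) G w + p.2 * splitSum π F (fun u => G (b :: u)) w
  | [], _, _, _ :: _ => 0
  | _ :: _, _, _, [] => 0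

theorem splitSum_add_left (π : List (ℕ × ℕ)) (F F' G : List ℕ → ℕ) (w : List ℕ) :
    splitSum π (fun u => F u + F' u) G w = splitSum π F G w + splitSum π F' G w := by
  induction π generalizing F F' G w with
  | nil => cases w <;> simp [splitSum, add_mul]
  | cons p π ih => cases w <;> simp [splitSum, ih]; ring

theorem splitSum_add_right (π : List (ℕ × ℕ)) (F G G' : List ℕ → ℕ) (w : List ℕ) :
    splitSum π F (fun u => G u + G' u) w = splitSum π F G w + splitSum π F G' w := by
  induction π generalizing F G G' w with
  | nil => cases w <;> simp [splitSum, mul_add]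
  | cons p π ih => cases w <;> simp [splitSum, ih]; ring

theorem splitSum_zero_left (π : List (ℕ × ℕ)) (G : List ℕ → ℕ) (w : List ℕ) :
    splitSum π (fun _ => 0) G w = 0 := by
  induction π generalizing G w with
  | nil => cases w <;> simp [splitSum]
  | cons p π ih => cases w <;> simp [splitSum, ih]

theorem splitSum_zero_right (π : List (ℕ × ℕ)) (F : List ℕ → ℕ) (w : List ℕ) :
    splitSum π F (fun _ => 0) w = 0 := by
  induction π generalizing F w with
  | nil => cases w <;> simp [splitSum]
  | cons p π ih => cases w <;> simp [splitSum, ih]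

/-- The Leibniz rule: a replacement in a split word takes place in exactly one of its two parts. -/
theorem replacementSum_splitSum (a : ℕ) (π : List (ℕ × ℕ)) (F G : List ℕ → ℕ) (w : List ℕ) :
    replacementSum a (splitSum π F G) w =
      splitSum π (replacementSum a F) G w + splitSum π F (replacementSum a G) w := by
  induction π generalizing F G w with
  | nil =>
    cases w with
    | nil => simp [splitSum]
    | cons b w => simp [splitSum, replacementSum_cons, replacementSum_zero]
  | cons p π ih =>
    cases w with
    | nil => simp [splitSum]
    | cons b w =>
      simp only [splitSum, replacementSum_cons, replacementSum_linear, ih, splitSum_add_left,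
        splitSum_add_right]
      by_cases hab : a < b
      · simp only [hab, if_true]; ring
      · simp only [hab, if_false, splitSum_zero_left, splitSum_zero_right]; ring

/-- A weight with second entry `0` makes the left part of every contributing splitting
nonempty. -/
theorem splitSum_congr_left {π : List (ℕ × ℕ)} (hπ : ∃ p ∈ π, p.2 = 0) {F F' : List ℕ → ℕ}
    (h : ∀ u ≠ [], F u = F' u) (G : List ℕ → ℕ) (w : List ℕ) :
    splitSum π F G w = splitSum π F' G w := by
  induction π generalizing G w with
  | nil => simp at hπ
  | cons p π ih =>
    cases w with
    | nil => rfl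
    | cons b w =>
      simp only [splitSum]
      congr 1
      · simp [h]
      · by_cases hp : p.2 = 0
        · simp [hp]
        · rw [ih (by simpa [hp] using hπ)]

/-- A weight with first entry `0` makes the right part of every contributing splitting
nonempty. -/
theorem splitSum_congr_right {π : List (ℕ × ℕ)} (hπ : ∃ p ∈ π, p.1 = 0) {G G' : List ℕ → ℕ}
    (h : ∀ u ≠ [], G u = G' u) (F : List ℕ → ℕ) (w : List ℕ) :
    splitSum π F G w = splitSum π F G' w := by
  induction π generalizing F w with
  | nil => simp at hπ
  | cons p π ih =>
    cases w with
    | nil => rfl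
    | cons b w =>
      simp only [splitSum]
      congr 1
      · by_cases hp : p.1 = 0
        · simp [hp]
        · rw [ih (by simpa [hp] using hπ)]
      · simp [h]

/-- If `F` and `G` depend on the lengths of subwords only, a sum over splittings with `m` free
positions is a binomial convolution. The weights `τ` force `s` positions into the left part and
`t` into the right part. -/
theorem splitSum_eq_sum_choose {τ : List (ℕ × ℕ)} {s t : ℕ}
    (hτ : ∀ (F G : List ℕ → ℕ) (φ γ : ℕ → ℕ) (w : List ℕ), w.length = τ.length →
      (∀ u, u.Sublist w → F u = φ u.length) → (∀ u, u.Sublist w → G u = γ u.length) →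
      splitSum τ F G w = φ s * γ t) (m : ℕ) {F G : List ℕ → ℕ} {φ γ : ℕ → ℕ} {w : List ℕ}
    (hw : w.length = m + τ.length) (hF : ∀ u, u.Sublist w → F u = φ u.length)
    (hG : ∀ u, u.Sublist w → G u = γ u.length) :
    splitSum (List.replicate m (1, 1) ++ τ) F G w =
      ∑ ij ∈ Finset.HasAntidiagonal.antidiagonal m, m.choose ij.1 * (φ (ij.1 + s) * γ (ij.2 + t)) := by
  induction m generalizing F G φ γ w with
  | zero => simpa using hτ F G φ γ w (by simpa using hw) hF hG
  | succ m ih =>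
    cases w with
    | nil => simp at hw; omega
    | cons b w =>
      have hlen : w.length = m + τ.length := by simp at hw; omega
      rw [List.replicate_succ, List.cons_append, splitSum, one_mul, one_mul,
        ih (φ := fun k => φ (k + 1)) (γ := γ) hlen
          (fun u hu => by simpa using hF _ (hu.cons_cons b)) (fun u hu => hG _ (hu.cons b)),
        ih (φ := φ) (γ := fun k => γ (k + 1)) hlen (fun u hu => hF _ (hu.cons b))
          (fun u hu => by simpa using hG _ (hu.cons_cons b))]
      have := Finset.sum_antidiagonal_choose_succ_mul (R := ℕ)
        (fun i j => φ (i + s) * γ (j + t)) m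
      simp only [Nat.cast_id] at this
      rw [this, add_comm]
      congr 1
      · refine Finset.sum_congr rfl fun ij _ => ?_
        rw [add_right_comm]
      · refine Finset.sum_congr rfl fun ij hij => ?_
        rw [add_right_comm,
          ← Nat.choose_symm_of_eq_add (Finset.HasAntidiagonal.mem_antidiagonal.1 hij).symm]

/-- Summation over the part that forms a cycle with the last position. -/
theorem webCount_eq_splitSum {m : ℕ} {w : List ℕ} (hw : w.length = m + 1) :
    webCount w = splitSum (List.replicate m (1, 1) ++ [(1, 0)]) cycleCount webCount w := by
  induction m generalizing w with
  | zero =>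
    obtain ⟨a, rfl⟩ := List.length_eq_one_iff.1 hw
    simp [splitSum, webCount_cons, cycleCount_singleton]
  | succ m ih =>
    cases w with
    | nil => simp at hw
    | cons a w =>
      have hw' : w.length = m + 1 := by simpa using hw
      rw [List.replicate_succ, List.cons_append, splitSum, one_mul, one_mul, webCount_cons]
      set π : List (ℕ × ℕ) := List.replicate m (1, 1) ++ [(1, 0)] with hπ
      rw [
        replacementSum_congr (G := splitSum π cycleCount webCount)
          (fun u hu => ih ((length_of_mem_replacements hu).trans hw')),
        replacementSum_splitSum, splitSum_congr_left (F := fun u => cycleCount (a :: u))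
          (F' := replacementSum a cycleCount) ⟨(1, 0), by simp [hπ], rfl⟩
          (fun u hu => cycleCount_cons_of_ne_nil a hu)]
      simp only [webCount_cons, splitSum_add_right, ← ih hw']
      ring

theorem eq_or_mem_of_mem_replacements {a x : ℕ} {w u : List ℕ} (hu : u ∈ replacements a w)
    (hx : x ∈ u) : x = a ∨ x ∈ w := by
  induction w generalizing u with
  | nil => simp [replacements] at hu
  | cons b w ih =>
    simp only [replacements, List.mem_append, List.mem_map] at hu
    rcases hu with hu | ⟨v, hv, rfl⟩
    · split_ifs at hu with hab
      · simp only [List.mem_singleton] at hu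
        subst hu
        simp only [List.mem_cons] at hx ⊢
        tauto
      · simp at hu
    · have := @ih v hv
      simp only [List.mem_cons] at hx ⊢
      tauto

theorem mem_of_mem_replacements {a : ℕ} {w u : List ℕ} (hu : u ∈ replacements a w) : a ∈ u := by
  induction w generalizing u with
  | nil => simp [replacements] at hu
  | cons b w ih =>
    simp only [replacements, List.mem_append, List.mem_map] at hu
    rcases hu with hu | ⟨v, hv, rfl⟩
    · split_ifs at hu with hab <;> simp_all
    · simp [ih hv]

theorem mem_iff_of_mem_replacements {m a : ℕ} (h : m < a) {w u : List ℕ}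
    (hu : u ∈ replacements a w) : m ∈ u ↔ m ∈ w := by
  induction w generalizing u with
  | nil => simp [replacements] at hu
  | cons b w ih =>
    simp only [replacements, List.mem_append, List.mem_map] at hu
    rcases hu with hu | ⟨v, hv, rfl⟩
    · split_ifs at hu with hab
      · simp only [List.mem_singleton] at hu
        subst hu
        simp [h.ne, (h.trans hab).ne]
      · simp at hu
    · simp [ih hv]

theorem nodup_of_mem_replacements {a : ℕ} {w u : List ℕ} (hw : (a :: w).Nodup)
    (hu : u ∈ replacements a w) : u.Nodup := by
  induction w generalizing u with
  | nil => simp [replacements] at hu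
  | cons b w ih =>
    simp only [List.nodup_cons, List.mem_cons, not_or] at hw
    simp only [replacements, List.mem_append, List.mem_map] at hu
    rcases hu with hu | ⟨v, hv, rfl⟩
    · split_ifs at hu with hab
      · simp only [List.mem_singleton] at hu
        subst hu
        simp [hw]
      · simp at hu
    · rw [List.nodup_cons]
      refine ⟨fun hb => ?_, ih (by simp [hw]) hv⟩
      rcases eq_or_mem_of_mem_replacements hv hb with h | h
      · exact hw.1.1 h.symm
      · exact hw.2.1 h

/-- The function `F`, set to `0` on words that do not contain the letter `m`. -/
def restrictMem (m : ℕ) (F : List ℕ → ℕ) (w : List ℕ) : ℕ := if m ∈ w then F w else 0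

theorem replacementSum_restrictMem_of_lt {m a : ℕ} (h : m < a) (F : List ℕ → ℕ) (w : List ℕ) :
    replacementSum a (restrictMem m F) w = restrictMem m (replacementSum a F) w := by
  by_cases hm : m ∈ w
  · rw [restrictMem, if_pos hm]
    exact replacementSum_congr fun u hu => by
      simp [restrictMem, (mem_iff_of_mem_replacements h hu).2 hm]
  · rw [restrictMem, if_neg hm, ← replacementSum_zero a w]
    exact replacementSum_congr fun u hu => by
      simp [restrictMem, mt (mem_iff_of_mem_replacements h hu).1 hm]

theorem replacementSum_restrictMem_self (m : ℕ) (F : List ℕ → ℕ) (w : List ℕ) :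
    replacementSum m (restrictMem m F) w = replacementSum m F w :=
  replacementSum_congr fun u hu => by simp [restrictMem, mem_of_mem_replacements hu]

/-- Shortly before the end, a word of length two `[c, d]` is left; it counts for one cycle iff
`c < d`. This is so iff the least letter, which is never replaced, has ended up in the first place. -/
theorem cycleCount_eq_splitSum {m k : ℕ} {w : List ℕ} (hw : w.length = k + 2) (hnd : w.Nodup)
    (hm : m ∈ w) (hle : ∀ x ∈ w, m ≤ x) :
    cycleCount w = splitSum (List.replicate k (1, 1) ++ [(1, 0), (0, 1)])
      (restrictMem m cycleCount) cycleCount w := by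
  induction k generalizing w with
  | zero =>
    obtain ⟨c, d, rfl⟩ := List.length_eq_two.1 hw
    have hcd : c < d ↔ m = c := by
      simp only [List.mem_cons, List.not_mem_nil, or_false, List.nodup_cons, forall_eq_or_imp,
        forall_eq] at hm hle hnd
      omega
    simp [splitSum, restrictMem, cycleCount_cons, replacementSum_cons, hcd]
  | succ k ih =>
    cases w with
    | nil => simp at hw
    | cons a w =>
      have hw' : w.length = k + 2 := by simpa using hw
      have hne : w ≠ [] := by rintro rfl; simp at hw'
      rw [List.replicate_succ, List.cons_append, splitSum, one_mul, one_mul,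
        cycleCount_cons_of_ne_nil a hne]
      set π : List (ℕ × ℕ) := List.replicate k (1, 1) ++ [(1, 0), (0, 1)] with hπ
      have hleft : ∃ p ∈ π, p.2 = 0 := ⟨(1, 0), by simp [hπ], rfl⟩
      have hright : ∃ p ∈ π, p.1 = 0 := ⟨(0, 1), by simp [hπ], rfl⟩
      rw [replacementSum_congr (G := splitSum π (restrictMem m cycleCount) cycleCount),
        replacementSum_splitSum,
        splitSum_congr_right hright (G := fun u => cycleCount (a :: u))
          (G' := replacementSum a cycleCount) (fun u hu => cycleCount_cons_of_ne_nil a hu)]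
      -- If `a` is the least letter `m`, both sides only ask for splittings with `a` in the left
      -- part; otherwise `m < a`, and moving `a` does not affect where `m` is.
      · congr 1
        refine splitSum_congr_left hleft (fun u hu => ?_) _ _
        rcases (hle a (by simp)).eq_or_lt with rfl | hlt
        · simp [replacementSum_restrictMem_self, restrictMem, cycleCount_cons_of_ne_nil _ hu]
        · simp [replacementSum_restrictMem_of_lt hlt, restrictMem,
            cycleCount_cons_of_ne_nil _ hu, hlt.ne]
      · intro u hu
        refine ih ((length_of_mem_replacements hu).trans hw') (nodup_of_mem_replacements hnd hu)
          ?_ fun x hx => ?_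
        · rcases (hle a (by simp)).eq_or_lt with rfl | hlt
          · exact mem_of_mem_replacements hu
          · rw [mem_iff_of_mem_replacements hlt hu]
            simpa [hlt.ne] using hm
        · rcases eq_or_mem_of_mem_replacements hu hx with rfl | h
          · exact hle x (by simp)
          · exact hle x (by simp [h])

/-! ### Recursions for increasing words -/

theorem webCount_range_succ (m : ℕ) :
    webCount (List.range (m + 1)) = ∑ ij ∈ Finset.HasAntidiagonal.antidiagonal m,
      m.choose ij.1 * (cycleCount (List.range (ij.1 + 1)) * webCount (List.range ij.2)) := by
  rw [webCount_eq_splitSum (List.length_range)]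
  refine splitSum_eq_sum_choose (s := 1) (t := 0) (φ := fun k => cycleCount (List.range k))
    (γ := fun k => webCount (List.range k)) ?_ m (by simp)
    (fun u hu => cycleCount_eq_of_pairwise (List.pairwise_lt_range.sublist hu))
    (fun u hu => webCount_eq_of_pairwise (List.pairwise_lt_range.sublist hu))
  intro F G φ γ w hw hF hG
  obtain ⟨a, rfl⟩ := List.length_eq_one_iff.1 hw
  simp [splitSum, hF [a] (by simp), hG [] (by simp)]

theorem cycleCount_range_add_three (m : ℕ) :
    cycleCount (List.range (m + 3)) = ∑ ij ∈ Finset.HasAntidiagonal.antidiagonal m,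
      m.choose ij.1 *
        (cycleCount (List.range (ij.1 + 2)) * cycleCount (List.range (ij.2 + 1))) := by
  have hbase : ∀ (F G : List ℕ → ℕ) (φ γ : ℕ → ℕ) (w : List ℕ),
      w.length = [((1 : ℕ), (0 : ℕ)), (0, 1)].length →
      (∀ u, u.Sublist w → F u = φ u.length) → (∀ u, u.Sublist w → G u = γ u.length) →
      splitSum [(1, 0), (0, 1)] F G w = φ 1 * γ 1 := by
    intro F G φ γ w hw hF hG
    obtain ⟨a, b, rfl⟩ := List.length_eq_two.1 hw
    simp [splitSum, hF [a] (by simp), hG [b] (by simp)]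
  rw [cycleCount_eq_splitSum (m := 0) (k := m + 1) (List.length_range) List.nodup_range
    (by simp) (by simp)]
  rw [List.range_succ_eq_map, List.replicate_succ, List.cons_append, splitSum, one_mul, one_mul]
  have hlen : ((List.range (m + 2)).map Nat.succ).length
      = m + [((1 : ℕ), (0 : ℕ)), (0, 1)].length := by simp
  have hpw : ((0 : ℕ) :: (List.range (m + 2)).map Nat.succ).Pairwise (· < ·) := by
    rw [← List.range_succ_eq_map]; exact List.pairwise_lt_range
  rw [splitSum_eq_sum_choose hbase m hlen (φ := fun k => cycleCount (List.range (k + 1)))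
      (γ := fun k => cycleCount (List.range k)),
    splitSum_eq_sum_choose hbase m hlen (φ := fun _ => 0)
      (γ := fun k => cycleCount (List.range (k + 1)))]
  · simp
  -- Splittings with the least letter `0` in the right part contribute nothing.
  · intro u hu
    rw [restrictMem, if_neg]
    intro h0
    simpa using hu.subset h0
  · intro u hu
    exact cycleCount_eq_of_pairwise (hpw.sublist (hu.cons_cons 0))
  · intro u hu
    rw [restrictMem, if_pos (by simp)]
    exact cycleCount_eq_of_pairwise (hpw.sublist (hu.cons_cons 0))
  · intro u hu
    exact cycleCount_eq_of_pairwise (hpw.sublist (hu.cons 0))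

/-! ### The differential equation of `sec + tan` -/

section EulerNumbers

open PowerSeries

theorem derivative_sin : derivative ℚ (sin ℚ) = cos ℚ := by
  ext n
  rw [coeff_derivative, sin, cos, coeff_mk, coeff_mk]
  have : (n.factorial : ℚ) ≠ 0 := by exact_mod_cast n.factorial_ne_zero
  rcases Nat.even_or_odd n with h | h
  · rw [if_neg (by simpa [Nat.even_add_one] using h), if_pos h]
    obtain ⟨k, rfl⟩ := h
    have e1 : (k + k + 1) / 2 = k := by omega
    have e2 : (k + k) / 2 = k := by omega
    rw [e1, e2, Nat.factorial_succ]
    push_cast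
    field_simp
  · rw [if_pos (by simpa [Nat.even_add_one] using h), if_neg (by simpa using h), zero_mul]

theorem derivative_cos : derivative ℚ (cos ℚ) = -sin ℚ := by
  ext n
  rw [map_neg, coeff_derivative, sin, cos, coeff_mk, coeff_mk]
  have : (n.factorial : ℚ) ≠ 0 := by exact_mod_cast n.factorial_ne_zero
  rcases Nat.even_or_odd n with h | h
  · rw [if_pos h, if_neg (by simpa [Nat.even_add_one] using h), zero_mul, neg_zero]
  · rw [if_neg (Nat.not_even_iff_odd.2 h), if_pos h.add_one]
    obtain ⟨k, rfl⟩ := h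
    have e1 : (2 * k + 1 + 1) / 2 = k + 1 := by omega
    have e2 : (2 * k + 1) / 2 = k := by omega
    rw [e1, e2, Nat.factorial_succ (2 * k + 1)]
    push_cast
    simp [pow_succ]
    field_simp

theorem constantCoeff_cos : constantCoeff (cos ℚ) = 1 := by
  rw [← coeff_zero_eq_constantCoeff_apply, cos, coeff_mk]; simp

theorem constantCoeff_sin : constantCoeff (sin ℚ) = 0 := by
  rw [← coeff_zero_eq_constantCoeff_apply, sin, coeff_mk]; simp

theorem sin_sq_add_cos_sq : sin ℚ ^ 2 + cos ℚ ^ 2 = 1 := by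
  refine derivative.ext (R := ℚ) ?_ ?_
  · rw [map_add, derivative_pow, derivative_pow, derivative_sin, derivative_cos, derivative_one]
    ring
  · simp [constantCoeff_cos, constantCoeff_sin]

/-- The differential equation `2 y' = 1 + y ^ 2` of `y = sec z + tan z`. -/
theorem two_mul_derivative_secAddTan : 2 * derivative ℚ secAddTan = 1 + secAddTan ^ 2 := by
  have hC : cos ℚ * (cos ℚ)⁻¹ = 1 :=
    PowerSeries.mul_inv_cancel _ (by rw [constantCoeff_cos]; exact one_ne_zero)
  have h := sin_sq_add_cos_sq
  rw [secAddTan, map_add, Derivation.leibniz, derivative_inv', derivative_sin, derivative_cos,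
    smul_eq_mul, smul_eq_mul]
  set u := (cos ℚ)⁻¹
  linear_combination (2 : ℚ⟦X⟧) * hC + u ^ 2 * h - (u * cos ℚ + 1) * hC

theorem derivative_derivative_secAddTan :
    derivative ℚ (derivative ℚ secAddTan) = derivative ℚ secAddTan * secAddTan := by
  have h := congrArg (derivative ℚ) two_mul_derivative_secAddTan
  have h2 : derivative ℚ (2 : ℚ⟦X⟧) = 0 := by
    rw [← one_add_one_eq_two, map_add, derivative_one, add_zero]
  rw [Derivation.leibniz, map_add, derivative_one, derivative_pow, h2, smul_zero, add_zero,
    smul_eq_mul] at h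
  have h3 : (2 : ℚ⟦X⟧) ≠ 0 := fun h0 => by
    have := congrArg constantCoeff h0
    rw [map_ofNat, map_zero] at this
    norm_num at this
  refine mul_left_cancel₀ h3 ?_
  rw [h]
  push_cast
  ring

theorem eulerNumber_zero : eulerNumber 0 = 1 := by
  simp [eulerNumber, secAddTan, constantCoeff_cos, constantCoeff_sin]

theorem eulerNumber_one : eulerNumber 1 = 1 := by
  have h := congrArg constantCoeff two_mul_derivative_secAddTan
  have h0 : constantCoeff secAddTan = 1 := by
    simp [secAddTan, constantCoeff_cos, constantCoeff_sin]
  have h1 := coeff_derivative secAddTan 0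
  rw [coeff_zero_eq_constantCoeff_apply] at h1
  have h2 : constantCoeff (2 : ℚ⟦X⟧) = 2 := map_ofNat _ 2
  simp only [map_mul, map_add, map_pow, h0, h1, h2, map_one] at h
  simp only [eulerNumber, Nat.factorial_one]
  push_cast at h ⊢
  linarith

theorem eulerNumber_add_two (m : ℕ) :
    eulerNumber (m + 2) = ∑ ij ∈ Finset.HasAntidiagonal.antidiagonal m,
      (m.choose ij.1 : ℚ) * (eulerNumber (ij.1 + 1) * eulerNumber ij.2) := by
  have h := congrArg (coeff m) derivative_derivative_secAddTan
  rw [coeff_derivative, coeff_derivative, coeff_mul] at h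
  have e : eulerNumber (m + 2) = m.factorial * (coeff (m + 1 + 1) secAddTan *
      ((m + 1 : ℕ) + 1) * (m + 1)) := by
    rw [eulerNumber, Nat.factorial_succ, Nat.factorial_succ]
    push_cast
    ring
  rw [e, h, Finset.mul_sum]
  refine Finset.sum_congr rfl fun ij hij => ?_
  rw [Finset.HasAntidiagonal.mem_antidiagonal] at hij
  subst hij
  rw [coeff_derivative, eulerNumber, eulerNumber, Nat.factorial_succ,
    ← Nat.add_choose_mul_factorial_mul_factorial, Nat.choose_symm_add]
  push_cast
  ring

end EulerNumbers

theorem cycleCount_range_eq_eulerNumber (k : ℕ) :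
    (cycleCount (List.range (k + 1)) : ℚ) = eulerNumber k := by
  induction k using Nat.strong_induction_on with
  | _ k ih =>
    match k with
    | 0 => simp [cycleCount_singleton, eulerNumber_zero]
    | 1 =>
      rw [eulerNumber_one]
      simp [List.range_succ, cycleCount_cons, replacementSum_cons]
    | m + 2 =>
      rw [cycleCount_range_add_three, eulerNumber_add_two]
      push_cast
      refine Finset.sum_congr rfl fun ij hij => ?_
      rw [Finset.HasAntidiagonal.mem_antidiagonal] at hij
      rw [ih (ij.1 + 1) (by omega), ih ij.2 (by omega)]

theorem webCount_range_eq_eulerNumber (m : ℕ) :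
    (webCount (List.range m) : ℚ) = eulerNumber (m + 1) := by
  induction m using Nat.strong_induction_on with
  | _ m ih =>
    match m with
    | 0 => simp [eulerNumber_one]
    | m + 1 =>
      rw [webCount_range_succ, eulerNumber_add_two,
        ← Finset.Nat.sum_antidiagonal_swap]
      push_cast
      refine Finset.sum_congr rfl fun ij hij => ?_
      rw [Finset.HasAntidiagonal.mem_antidiagonal] at hij
      simp only [Prod.fst_swap, Prod.snd_swap]
      rw [ih ij.1 (by omega), cycleCount_range_eq_eulerNumber,
        Nat.choose_symm_of_eq_add (by omega : m = ij.2 + ij.1)]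
      ring

/-! ### Commuting resolutions -/

section Grid

variable {n : ℕ}

theorem mem_crossings {σ : Equiv.Perm (Fin n)} {i p : Fin n} :
    (i, σ p) ∈ crossings σ ↔ σ i < σ p ∧ i < p := by
  simp [crossings]

theorem exists_eq_of_mem_crossings {σ : Equiv.Perm (Fin n)} {c : Fin n × Fin n}
    (hc : c ∈ crossings σ) : ∃ i p, c = (i, σ p) ∧ σ i < σ p ∧ i < p := by
  refine ⟨c.1, σ⁻¹ c.2, by simp, ?_⟩
  simpa [crossings] using hc

theorem mem_crossings_mul_swap {σ : Equiv.Perm (Fin n)} {i p r q : Fin n} :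
    (r, σ q) ∈ crossings (σ * Equiv.swap i p) ↔
      σ (Equiv.swap i p r) < σ q ∧ r < Equiv.swap i p q := by
  simp [crossings]

/-- Switching at a crossing creates new crossings only to its lower right. -/
theorem upperLeft_of_mem_crossings_mul_swap {σ : Equiv.Perm (Fin n)} {i p : Fin n}
    (hσ : σ i < σ p) (hip : i < p) {e : Fin n × Fin n}
    (he : e ∈ crossings (σ * Equiv.swap i p)) (he' : e ∉ crossings σ) :
    UpperLeft (i, σ p) e := by
  obtain ⟨r, s⟩ := e
  obtain ⟨q, rfl⟩ := σ.surjective s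
  rw [mem_crossings_mul_swap, Equiv.swap_apply_def, Equiv.swap_apply_def] at he
  rw [mem_crossings] at he'
  simp only [UpperLeft]
  grind

namespace GridConfig

/-- Resolving a crossing: by switching for `true`, by smoothing for `false`. -/
def resolve (G : GridConfig n) (c : Fin n × Fin n) : Bool → GridConfig n
  | true => G.switch c
  | false => G.smooth c

theorem IsMaximalCrossing.step {G : GridConfig n} {c : Fin n × Fin n}
    (hc : G.IsMaximalCrossing c) (b : Bool) : ResolveStep G (G.resolve c b) :=
  ⟨c, hc, by cases b <;> simp [resolve]⟩

theorem ResolveStep.exists_resolve {G G' : GridConfig n} (h : ResolveStep G G') :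
    ∃ c b, G.IsMaximalCrossing c ∧ G' = G.resolve c b := by
  obtain ⟨c, hc, rfl | rfl⟩ := h
  · exact ⟨c, false, hc, rfl⟩
  · exact ⟨c, true, hc, rfl⟩

theorem IsMaximalCrossing.not_upperLeft {G : GridConfig n} {c d : Fin n × Fin n}
    (hc : G.IsMaximalCrossing c) (hd : G.IsMaximalCrossing d) (h : d ≠ c) : ¬ UpperLeft d c :=
  fun h' => h (hc.2 d hd.1 h')

theorem IsMaximalCrossing.mem {G : GridConfig n} {c : Fin n × Fin n}
    (hc : G.IsMaximalCrossing c) : c ∈ crossings G.perm := (Finset.mem_sdiff.1 hc.1).1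

theorem IsMaximalCrossing.notMem {G : GridConfig n} {c : Fin n × Fin n}
    (hc : G.IsMaximalCrossing c) : c ∉ G.elbows := (Finset.mem_sdiff.1 hc.1).2

/-- A maximal crossing stays maximal when another one is resolved. -/
theorem IsMaximalCrossing.resolve {G : GridConfig n} {c d : Fin n × Fin n}
    (hc : G.IsMaximalCrossing c) (hd : G.IsMaximalCrossing d) (hne : c ≠ d) (b : Bool) :
    (G.resolve d b).IsMaximalCrossing c := by
  cases b with
  | false =>
    refine ⟨?_, fun e he hec => hc.2 e ?_ hec⟩
    · simp [GridConfig.resolve, smooth, unresolved, hc.mem, hc.notMem, hne]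
    · simp only [GridConfig.resolve, smooth, unresolved, Finset.mem_sdiff, Finset.mem_insert,
        not_or] at he ⊢
      tauto
  | true =>
    have h1 := hc.not_upperLeft hd hne.symm
    have h2 := hd.not_upperLeft hc hne
    obtain ⟨k, q, rfl, hσd, hkq⟩ := exists_eq_of_mem_crossings hd.mem
    obtain ⟨i, p, rfl, hσc, hip⟩ := exists_eq_of_mem_crossings hc.mem
    have hperm : (G.resolve (k, G.perm q) true).perm = G.perm * Equiv.swap k q := by
      simp [GridConfig.resolve, switch]
    have hel : (G.resolve (k, G.perm q) true).elbows = G.elbows := rfl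
    refine ⟨?_, fun e he hec => ?_⟩
    · rw [unresolved, hperm, hel, Finset.mem_sdiff, mem_crossings_mul_swap]
      refine ⟨?_, hc.notMem⟩
      simp only [UpperLeft] at h1 h2
      rw [Equiv.swap_apply_def, Equiv.swap_apply_def]
      grind
    · rw [unresolved, hperm, hel, Finset.mem_sdiff] at he
      by_cases he' : e ∈ crossings G.perm
      · exact hc.2 e (Finset.mem_sdiff.2 ⟨he', he.2⟩) hec
      -- A new crossing above `c` would put `c` to the lower right of `d`.
      · have h3 := upperLeft_of_mem_crossings_mul_swap hσd hkq he.1 he'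
        exact absurd ⟨h3.1.trans hec.1, hec.2.trans h3.2⟩ h1

/-- The marked cell in column `σ p` may lie in row `k`. Then the two switches share a row, and the
claim is the identity `(i k) (k q) = (k q) (i q)` of transpositions. -/
theorem switch_switch_comm_of_lt {σ : Equiv.Perm (Fin n)} {i p k q : Fin n} (hip : i < p)
    (hσi : σ i < σ p) (hik : i < k) (hσ : σ p < σ q) (E : Finset (Fin n × Fin n)) :
    ((⟨σ, E⟩ : GridConfig n).switch (i, σ p)).switch (k, σ q) =
      ((⟨σ, E⟩ : GridConfig n).switch (k, σ q)).switch (i, σ p) := by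
  have hqi : q ≠ i := by rintro rfl; exact lt_asymm hσ hσi
  have hqp : q ≠ p := by rintro rfl; exact lt_irrefl _ hσ
  have hswap : Equiv.swap i p * Equiv.swap k q =
      Equiv.swap k q * Equiv.swap i (Equiv.swap k q p) := by
    ext r
    simp only [Equiv.Perm.mul_apply, Equiv.swap_apply_def]
    grind
  simp [switch, mul_assoc, Equiv.swap_apply_of_ne_of_ne hqi hqp, hswap]

theorem resolve_comm {G : GridConfig n} {c d : Fin n × Fin n} (hc : G.IsMaximalCrossing c)
    (hd : G.IsMaximalCrossing d) (hne : c ≠ d) (b b' : Bool) :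
    (G.resolve c b).resolve d b' = (G.resolve d b').resolve c b := by
  cases b <;> cases b'
  · simp [GridConfig.resolve, smooth, Finset.insert_comm]
  · rfl
  · rfl
  · have h1 := hc.not_upperLeft hd hne.symm
    have h2 := hd.not_upperLeft hc hne
    obtain ⟨k, q, rfl, hσd, hkq⟩ := exists_eq_of_mem_crossings hd.mem
    obtain ⟨i, p, rfl, hσc, hip⟩ := exists_eq_of_mem_crossings hc.mem
    simp only [UpperLeft, not_and, not_le] at h1 h2
    rcases lt_or_ge i k with hik | hki
    · exact switch_switch_comm_of_lt hip hσc hik (h2 hik.le) _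
    · have hσ := h1 hki
      have hki' : k < i := by
        refine lt_of_not_ge fun h => ?_
        exact lt_asymm hσ (h2 h)
      exact (switch_switch_comm_of_lt hkq hσd hki' hσ _).symm

/-! ### Independence of the order of resolution -/

/-- The permutations in the crossing-free configurations `G(σ, Cr(σ))` reachable from `G`. -/
def outcomes (G : GridConfig n) : Set (Equiv.Perm (Fin n)) :=
  {σ | Relation.ReflTransGen ResolveStep G ⟨σ, crossings σ⟩}

/-- A sequence of resolutions up to a configuration without crossings can be rearranged so that it
begins with any prescribed maximal crossing. -/
theorem exists_reflTransGen_resolve {G F : GridConfig n}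
    (h : Relation.ReflTransGen ResolveStep G F) (hF : F.unresolved = ∅) {c : Fin n × Fin n}
    (hc : G.IsMaximalCrossing c) :
    ∃ b, Relation.ReflTransGen ResolveStep (G.resolve c b) F := by
  induction h using Relation.ReflTransGen.head_induction_on generalizing c with
  | refl => simpa [hF] using hc.1
  | head hstep hrest ih =>
    obtain ⟨d, x, hd, rfl⟩ := hstep.exists_resolve
    by_cases hcd : c = d
    · subst hcd
      exact ⟨x, hrest⟩
    · obtain ⟨b, hb⟩ := ih (hc.resolve hd hcd x)
      rw [← resolve_comm hc hd hcd] at hb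
      exact ⟨b, hb.head ((hd.resolve hc (Ne.symm hcd) b).step x)⟩

theorem outcomes_eq_union {G : GridConfig n} {c : Fin n × Fin n} (hc : G.IsMaximalCrossing c) :
    G.outcomes = (G.smooth c).outcomes ∪ (G.switch c).outcomes := by
  ext σ
  constructor
  · intro h
    obtain ⟨b, hb⟩ := exists_reflTransGen_resolve h (by simp [unresolved]) hc
    cases b
    · exact Or.inl hb
    · exact Or.inr hb
  · rintro (h | h)
    · exact Relation.ReflTransGen.head (hc.step false) h
    · exact Relation.ReflTransGen.head (hc.step true) h

theorem outcomes_mk_crossings (σ : Equiv.Perm (Fin n)) :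
    (⟨σ, crossings σ⟩ : GridConfig n).outcomes = {σ} := by
  ext τ
  simp only [outcomes, Set.mem_ofPred_eq, Set.mem_singleton_iff]
  constructor
  · intro h
    rcases Relation.ReflTransGen.cases_head h with h | ⟨G, ⟨c, hc, -⟩, -⟩
    · exact ((GridConfig.mk.injEq _ _ _ _).mp h).1.symm
    · simpa [unresolved] using hc.1
  · rintro rfl
    exact .refl

theorem elbows_subset_of_reflTransGen {G F : GridConfig n}
    (h : Relation.ReflTransGen ResolveStep G F) : G.elbows ⊆ F.elbows := by
  induction h with
  | refl => exact subset_rfl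
  | tail _ hstep ih =>
    refine ih.trans ?_
    obtain ⟨c, hc, rfl | rfl⟩ := hstep
    · exact Finset.subset_insert _ _
    · exact subset_rfl

/-! ### Resolving row by row -/

/-- The configuration of `σ` in which exactly the crossings in rows above `i`, and those in row `i`
and columns at least `j`, have been smoothed. The bounds are natural numbers, so that `i` and `j`
may take the value `n`. -/
def rowwise (i j : ℕ) (σ : Equiv.Perm (Fin n)) : GridConfig n :=
  ⟨σ, (crossings σ).filter fun e => e.1.1 < i ∨ (e.1.1 = i ∧ j ≤ e.2.1)⟩

theorem rowwise_start : rowwise 0 n (1 : Equiv.Perm (Fin n)) = start n := by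
  rw [rowwise, start, Finset.filter_false_of_mem]
  intro e _
  have := e.2.2
  omega

theorem rowwise_end (σ : Equiv.Perm (Fin n)) : rowwise n n σ = ⟨σ, crossings σ⟩ := by
  rw [rowwise, Finset.filter_true_of_mem]
  intro e _
  exact Or.inl e.1.2

theorem rowwise_zero (i : ℕ) (σ : Equiv.Perm (Fin n)) : rowwise i 0 σ = rowwise (i + 1) n σ := by
  simp only [rowwise]
  congr 1
  refine Finset.filter_congr fun e _ => ?_
  have := e.2.2
  omega

theorem rowwise_succ_of_notMem {i j : Fin n} {σ : Equiv.Perm (Fin n)}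
    (h : (i, j) ∉ crossings σ) : rowwise i (j + 1) σ = rowwise i j σ := by
  simp only [rowwise]
  congr 1
  refine Finset.filter_congr fun e he => ?_
  have : ¬ (e.1.1 = i.1 ∧ e.2.1 = j.1) := fun h' =>
    h (by rwa [← Fin.ext h'.1, ← Fin.ext h'.2])
  omega

theorem isMaximalCrossing_rowwise {i j : Fin n} {σ : Equiv.Perm (Fin n)}
    (h : (i, j) ∈ crossings σ) : (rowwise i (j + 1) σ).IsMaximalCrossing (i, j) := by
  refine ⟨?_, fun e he hec => ?_⟩
  · simp [unresolved, rowwise, h]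
  · simp only [unresolved, rowwise, Finset.mem_sdiff, Finset.mem_filter, not_and] at he
    have h1 := he.2 he.1
    obtain ⟨r, s⟩ := e
    simp only [UpperLeft, Fin.le_def] at hec
    refine Prod.ext (Fin.ext ?_) (Fin.ext ?_) <;> simp only at h1 ⊢ <;> omega

theorem smooth_rowwise {i j : Fin n} {σ : Equiv.Perm (Fin n)}
    (h : (i, j) ∈ crossings σ) : (rowwise i (j + 1) σ).smooth (i, j) = rowwise i j σ := by
  simp only [rowwise, smooth]
  congr 1
  ext ⟨r, s⟩
  simp only [Finset.mem_insert, Finset.mem_filter, Prod.mk.injEq]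
  by_cases hrs : r = i ∧ s = j
  · obtain ⟨rfl, rfl⟩ := hrs
    simp [h]
  · simp only [hrs, false_or]
    rw [Fin.ext_iff, Fin.ext_iff] at hrs
    refine and_congr_right fun _ => ?_
    omega

/-- After a switch row `i` has no crossing left in the columns not yet treated, so that the next
row can begin. -/
theorem switch_rowwise {i p : Fin n} {σ : Equiv.Perm (Fin n)}
    (hσ : σ i < σ p) (hip : i < p) :
    (rowwise i (σ p + 1) σ).switch (i, σ p) = rowwise (i + 1) n (σ * Equiv.swap i p) := by
  simp only [rowwise, switch, Equiv.Perm.inv_def, Equiv.symm_apply_apply]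
  congr 1
  refine Finset.ext fun e => ?_
  obtain ⟨r, s⟩ := e
  obtain ⟨q, rfl⟩ := σ.surjective s
  simp only [Finset.mem_filter, mem_crossings, mem_crossings_mul_swap, Equiv.swap_apply_def]
  have := (σ q).2
  have hinj : σ q = σ i ↔ q = i := σ.injective.eq_iff
  have hinj' : σ q = σ p ↔ q = p := σ.injective.eq_iff
  simp only [Fin.lt_def, Fin.ext_iff] at *
  grind

/-- The word of the values of `σ` in row `i` and the rows below. -/
def rowWord (i : ℕ) (σ : Equiv.Perm (Fin n)) : List ℕ :=
  ((List.finRange n).drop i).map fun p => (σ p : ℕ)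

end GridConfig

/-! ### Counting the outcomes -/

theorem replacementSum_map {α : Type*} [DecidableEq α] (a : ℕ) (F : List ℕ → ℕ) (g : α → ℕ)
    {L : List α} (hL : L.Nodup) :
    replacementSum a F (L.map g) =
      ∑ p ∈ L.toFinset with a < g p, F (L.map (Function.update g p a)) := by
  induction L generalizing F with
  | nil => simp
  | cons q L ih =>
    rw [List.nodup_cons] at hL
    have hq : q ∉ L.toFinset.filter (a < g ·) := by simp [hL.1]
    rw [List.map_cons, replacementSum_cons, ih _ hL.2, List.toFinset_cons, Finset.filter_insert]
    have h1 : ∑ p ∈ L.toFinset with a < g p, F (g q :: L.map (Function.update g p a)) =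
        ∑ p ∈ L.toFinset with a < g p, F ((q :: L).map (Function.update g p a)) := by
      refine Finset.sum_congr rfl fun p hp => ?_
      have hqp : q ≠ p := by rintro rfl; exact hq hp
      rw [List.map_cons, Function.update_of_ne hqp]
    have h2 : L.map (Function.update g q a) = L.map g :=
      List.map_congr_left fun x hx =>
        Function.update_of_ne (by rintro rfl; exact hL.1 hx) _ _
    rw [h1]
    split_ifs with h
    · rw [Finset.sum_insert hq, List.map_cons, Function.update_self, h2]
    · rw [zero_add]

theorem mem_drop_finRange {i : ℕ} {p : Fin n} : p ∈ (List.finRange n).drop i ↔ i ≤ p.1 := by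
  rw [List.mem_drop_iff_getElem]
  constructor
  · rintro ⟨j, hj, rfl⟩
    simp
  · intro h
    exact ⟨p.1 - i, by simp; omega, by ext; simp; omega⟩

namespace GridConfig

theorem rowWord_eq_cons (i : Fin n) (σ : Equiv.Perm (Fin n)) :
    rowWord i σ = (σ i : ℕ) :: rowWord (i + 1) σ := by
  rw [rowWord, List.drop_eq_getElem_cons (by simp)]
  simp [rowWord]

theorem webCount_rowWord (i : Fin n) (σ : Equiv.Perm (Fin n)) :
    webCount (rowWord i σ) = webCount (rowWord (i + 1) σ) +
      ∑ p with i < p ∧ σ i < σ p, webCount (rowWord (i + 1) (σ * Equiv.swap i p)) := by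
  rw [rowWord_eq_cons, webCount_cons]
  congr 1
  rw [rowWord, replacementSum_map _ _ _ ((List.nodup_finRange n).sublist (List.drop_sublist _ _))]
  refine Finset.sum_congr ?_ fun p hp => ?_
  · ext p
    simp [mem_drop_finRange]
  · have hip : i < p := (Finset.mem_filter.1 hp).2.1
    congr 1
    refine List.map_congr_left fun q hq => ?_
    rw [mem_drop_finRange] at hq
    have hqi : q ≠ i := by rintro rfl; omega
    by_cases hqp : q = p
    · subst hqp
      simp
    · simp [Function.update_of_ne hqp, Equiv.swap_apply_of_ne_of_ne hqi hqp]

/-- Within row `i`, the columns are treated in decreasing order: the induction on `j` accounts for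
the possible switches at columns below `j`. -/
theorem outcomes_rowwise_of_next_row {i : Fin n}
    (ih : ∀ σ : Equiv.Perm (Fin n),
      (rowwise (i + 1) n σ).outcomes.ncard = webCount (rowWord (i + 1) σ) ∧
        ∀ τ ∈ (rowwise (i + 1) n σ).outcomes, ∀ r : Fin n, r.1 < i + 1 → τ r = σ r)
    (σ : Equiv.Perm (Fin n)) {j : ℕ} (hj : j ≤ n) :
    (rowwise i j σ).outcomes.ncard = webCount (rowWord (i + 1) σ) +
        ∑ p with (i < p ∧ σ i < σ p) ∧ (σ p).1 < j,
          webCount (rowWord (i + 1) (σ * Equiv.swap i p)) ∧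
      ∀ τ ∈ (rowwise i j σ).outcomes, ∀ r < i, τ r = σ r := by
  induction j with
  | zero =>
    rw [rowwise_zero]
    refine ⟨by simp [(ih σ).1], fun τ hτ r hr => (ih σ).2 τ hτ r ?_⟩
    exact Nat.lt_succ_of_lt hr
  | succ j ihj =>
    obtain ⟨hcard, hfix⟩ := ihj (by omega)
    obtain ⟨p, hp⟩ := σ.surjective ⟨j, by omega⟩
    have hpj : (σ p).1 = j := by rw [hp]
    by_cases hc : σ i < σ p ∧ i < p
    · have hmem : (i, σ p) ∈ crossings σ := mem_crossings.2 hc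
      have hmax := isMaximalCrossing_rowwise hmem
      have hunion := outcomes_eq_union hmax
      rw [smooth_rowwise hmem, switch_rowwise hc.1 hc.2, hpj] at hunion
      obtain ⟨hcard', hfix'⟩ := ih (σ * Equiv.swap i p)
      have hdisj : Disjoint (rowwise i j σ).outcomes
          (rowwise (i + 1) n (σ * Equiv.swap i p)).outcomes := by
        refine Set.disjoint_left.2 fun τ h1 h2 => ?_
        have h3 := hfix' τ h2 i (Nat.lt_succ_self _)
        -- An elbow at `(i, σ p)` forces `τ i < σ p`, whereas the switch gives `τ i = σ p`.
        have h4 : (i, σ p) ∈ crossings τ :=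
          elbows_subset_of_reflTransGen h1 (by simp [rowwise, hmem, hpj])
        simp only [Equiv.Perm.mul_apply, Equiv.swap_apply_left] at h3
        rw [← h3, mem_crossings] at h4
        exact lt_irrefl _ h4.1
      constructor
      · rw [hunion, Set.ncard_union_eq hdisj (Set.toFinite _) (Set.toFinite _), hcard, hcard',
          add_assoc]
        congr 1
        have hfilter : (Finset.univ.filter fun q => (i < q ∧ σ i < σ q) ∧ (σ q).1 < j + 1) =
            insert p (Finset.univ.filter fun q => (i < q ∧ σ i < σ q) ∧ (σ q).1 < j) := by
          ext q
          have hq : q = p ↔ (σ q).1 = j := by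
            rw [← hpj, ← Fin.ext_iff, σ.injective.eq_iff]
          simp only [Finset.mem_filter, Finset.mem_univ, true_and, Finset.mem_insert]
          by_cases h : q = p
          · subst h
            simp [hc, hpj]
          · have : (σ q).1 ≠ j := mt hq.2 h
            simp only [h, false_or]
            refine and_congr_right fun _ => ?_
            omega
        rw [hfilter, Finset.sum_insert (by simp [hpj]), add_comm]
      · intro τ hτ r hr
        rw [hunion] at hτ
        rcases hτ with hτ | hτ
        · exact hfix τ hτ r hr
        · rw [hfix' τ hτ r (Nat.lt_succ_of_lt hr), Equiv.Perm.mul_apply,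
            Equiv.swap_apply_of_ne_of_ne hr.ne (hr.trans hc.2).ne]
    · have hmem : (i, σ p) ∉ crossings σ := mt mem_crossings.1 hc
      have hrow := rowwise_succ_of_notMem hmem
      rw [hpj] at hrow
      rw [hrow]
      refine ⟨hcard.trans ?_, hfix⟩
      congr 1
      refine Finset.sum_congr (Finset.filter_congr fun q _ => ?_) fun _ _ => rfl
      refine and_congr_right fun hq => ?_
      have : (σ q).1 ≠ j := by
        rw [← hpj, ne_eq, ← Fin.ext_iff, σ.injective.eq_iff]
        rintro rfl
        exact hc hq.symm
      omega

/-- The number of outcomes once the rows above `i` are finished. The second part, that finished rows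
keep their values, makes the outcomes of smoothing and of switching disjoint. -/
theorem outcomes_rowwise {i : ℕ} (hi : i ≤ n) (σ : Equiv.Perm (Fin n)) :
    (rowwise i n σ).outcomes.ncard = webCount (rowWord i σ) ∧
      ∀ τ ∈ (rowwise i n σ).outcomes, ∀ r : Fin n, r.1 < i → τ r = σ r := by
  induction hi using Nat.decreasingInduction generalizing σ with
  | self =>
    rw [rowwise_end, outcomes_mk_crossings]
    refine ⟨?_, by simp⟩
    rw [rowWord, List.drop_of_length_le (by simp)]
    simp
  | of_succ i hi ih =>
    obtain ⟨h1, h2⟩ := outcomes_rowwise_of_next_row (i := ⟨i, hi⟩) ih σ le_rfl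
    refine ⟨?_, fun τ hτ r hr => h2 τ hτ r hr⟩
    rw [h1, webCount_rowWord ⟨i, hi⟩]
    congr 1
    refine Finset.sum_congr (Finset.filter_congr fun q _ => ?_) fun _ _ => rfl
    simp

end GridConfig

end Grid

theorem ncard_webPermutations (n : ℕ) :
    (webPermutations n).ncard = webCount (List.range n) := by
  have h := (GridConfig.outcomes_rowwise n.zero_le (1 : Equiv.Perm (Fin n))).1
  rw [GridConfig.rowwise_start] at h
  rw [← List.map_coe_finRange_eq_range]
  exact h

theorem corollary4p2 (n : ℕ) :
    ((webPermutations n).ncard : ℚ) = eulerNumber (n + 1) := by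
  rw [ncard_webPermutations, webCount_range_eq_eulerNumber]
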